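/- Let $d\ge 0$ and let $\mathcal A$ be a finite set of affine hyperplanes in $\mathbb R^d$ having a common point (a central hyperplane arrangement). Let $L$ be its intersection lattice, i.e. the set of all intersections $M_p$ of subsets of $\mathcal A$ (the empty subset giving $\mathbb R^d$), ordered by reverse inclusion, with minimal element $\mathbf 0$, maximal element $\mathbf 1$ and rank function $r$ (so $r(p)$ is the length of a maximal chain from $\mathbf 0$ to $p$). For $p\in L$ put $S_p=M_p\setminus\bigcup_{q>p}M_q$; a face of $\mathcal A$ is a connected component of some $S_p$, and a $k$-face is a face whose affine span has dimension $k$. For a finite geometric lattice $L'$ and a field $K$, let $E^*(L')$ be the exterior algebra over $K$ on generators $e_a$, $a$ an atom of $L'$, with $e_S=e_{a_1}\cdots e_{a_n}$ for $S=\{a_1,\dots,a_n\}$, and let $\partial$ be its derivation with $\partial e_S=\sum_{j=1}^{n}(-1)^{j-1}e_{a_1}\cdots\widehat{e_{a_j}}\cdots e_{a_n}$ (and $\partial 1=0$). A set $S$ of atoms is dependent if $r(\bigvee S)<|S|$. The Orlik–Solomon algebra is $A^*(L')=E^*(L')/\mathcal I(L')$, where $\mathcal I(L')$ is the two-sided ideal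 generated by all $\partial e_S$ with $S$ dependent. Then, for every field $K$ and every integer $k\ge 0$, the set of $k$-faces of $\mathcal A$ is finite, the Orlik–Solomon algebras $A^*([p,\mathbf 1])$, $p\in L$, over $K$ are finite-dimensional, and $$\#\{k\text{-faces of }\mathcal A\}=\sum_{p\in L,\ r(p)=d-k}\dim_K A^*([p,\mathbf 1]).$$ -/

import Mathlib

open Module

/-! ### The Orlik–Solomon algebra of a finite (geometric) lattice

The rank `r(x)` of an element is `Order.height x`, the length of a longest chain from the
minimal element to `x`. -/

namespace OrlikSolomon

/-- The set of atoms of `L`. -/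
abbrev Atom (L : Type*) [Lattice L] [OrderBot L] : Type _ := {a : L // IsAtom a}

section

variable (K : Type*) [Field K] (L : Type*) [Lattice L] [OrderBot L]

/-- The exterior algebra `E(L)` over `K` on generators `e_a`, `a ∈ Atom(L)`. -/
abbrev Ext : Type _ := ExteriorAlgebra K (Atom L →₀ K)

/-- The monomial `e_{v 0} ⋯ e_{v (n-1)}` of `E(L)`. -/
noncomputable def monomial {n : ℕ} (v : Fin n → Atom L) : Ext K L :=
  ExteriorAlgebra.ιMulti K n (fun i => Finsupp.single (v i) (1 : K))

/-- The derivation `∂` of `E(L)`: contraction with the linear form sending every `e_a` to `1`. -/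
noncomputable def boundary : Ext K L →ₗ[K] Ext K L :=
  CliffordAlgebra.contractLeft (Q := (0 : QuadraticForm K (Atom L →₀ K)))
    (Finsupp.linearCombination K (fun _ : Atom L => (1 : K)))

/-- `∂ 1 = 0`, where `1` is the monomial of the empty set. -/
theorem boundary_monomial_zero (v : Fin 0 → Atom L) : boundary K L (monomial K L v) = 0 := by
  rw [monomial, ExteriorAlgebra.ιMulti_zero_apply]
  exact CliffordAlgebra.contractLeft_one _ _

theorem monomial_succ {n : ℕ} (v : Fin (n + 1) → Atom L) :
    monomial K L v = ExteriorAlgebra.ι K (Finsupp.single (v 0) (1 : K)) *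
      monomial K L (fun i => v i.succ) := by
  rw [monomial, ExteriorAlgebra.ιMulti_succ_apply]
  rfl

/-- The usual formula: `∂ (e_{a_0} ⋯ e_{a_n})` is the alternating sum of the monomials in which
one factor has been removed. -/
theorem boundary_monomial_succ {n : ℕ} (v : Fin (n + 1) → Atom L) :
    boundary K L (monomial K L v) =
      ∑ j : Fin (n + 1), (-1 : K) ^ (j : ℕ) • monomial K L (fun i => v (j.succAbove i)) := by
  have step : ∀ {m : ℕ} (w : Fin (m + 1) → Atom L), boundary K L (monomial K L w) =
      monomial K L (fun i => w i.succ) -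
        ExteriorAlgebra.ι K (Finsupp.single (w 0) (1 : K)) *
          boundary K L (monomial K L (fun i => w i.succ)) := by
    intro m w
    rw [monomial_succ]
    refine (CliffordAlgebra.contractLeft_ι_mul _ _ _).trans ?_
    rw [Finsupp.linearCombination_single, smul_eq_mul, one_mul, one_smul]
    rfl
  induction n with
  | zero =>
    rw [step, boundary_monomial_zero, Fin.sum_univ_succ]
    simp
  | succ n ih =>
    rw [step, ih, Fin.sum_univ_succ (n := n + 1), Finset.mul_sum, sub_eq_add_neg, ← Finset.sum_neg_distrib]
    congr 1
    · simp
    · refine Finset.sum_congr rfl fun j _ => ?_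
      rw [monomial_succ K L (fun i => v (j.succ.succAbove i)), mul_smul_comm, ← neg_smul]
      simp [pow_succ]

variable {L} in
/-- A finite set `S` of atoms is dependent if `r(⋁ S) < |S|`. -/
def IsDependent (S : Finset (Atom L)) : Prop :=
  Order.height (S.sup Subtype.val) < (S.card : ℕ∞)

/-- The elements `∂ e_S` for `S` dependent; all orderings of the elements of `S` are used, which
changes `e_S` by a sign only. -/
def relations : Set (Ext K L) :=
  {x | ∃ (n : ℕ) (v : Fin n ↪ Atom L),
    IsDependent (Finset.univ.map v) ∧ x = boundary K L (monomial K L v)}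

/-- The Orlik–Solomon ideal: the two-sided ideal generated by the `∂ e_S`, `S` dependent. -/
noncomputable def ideal : TwoSidedIdeal (Ext K L) := TwoSidedIdeal.span (relations K L)

/-- The Orlik–Solomon algebra `A(L) = E(L) / I(L)`. -/
abbrev OSAlgebra : Type _ := (ideal K L).ringCon.Quotient

end

end OrlikSolomon

/-! ### Hyperplane arrangements and their faces -/

namespace HyperplaneArrangement

section

variable {V : Type*} [AddCommGroup V] [Module ℝ V]

/-- An affine hyperplane of a finite-dimensional real vector space. -/
def IsHyperplane (H : AffineSubspace ℝ V) : Prop :=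
  (H : Set V).Nonempty ∧ finrank ℝ H.direction + 1 = finrank ℝ V

/-- A finite set of affine hyperplanes is a central arrangement if the hyperplanes have a common
point. -/
def IsCentralArrangement (A : Finset (AffineSubspace ℝ V)) : Prop :=
  (∀ H ∈ A, IsHyperplane H) ∧ ∃ x : V, ∀ H ∈ A, x ∈ H

/-- The intersection lattice of `A`: all intersections of subsets of `A`, ordered by reverse
inclusion; the intersection of the empty subset is the whole space `V`. (If `A` is central, all
these intersections are nonempty.) -/
def IntersectionLattice (A : Finset (AffineSubspace ℝ V)) : Type _ :=
  {X : (AffineSubspace ℝ V)ᵒᵈ // ∃ B ⊆ A, X = OrderDual.toDual (sInf (B : Set (AffineSubspace ℝ V)))}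

namespace IntersectionLattice

variable {A : Finset (AffineSubspace ℝ V)}

/-- The affine subspace `M_p` of `V` which the lattice element `p` is. -/
def flat (p : IntersectionLattice A) : AffineSubspace ℝ V := OrderDual.ofDual p.1

instance : PartialOrder (IntersectionLattice A) := Subtype.partialOrder _

theorem le_iff (p q : IntersectionLattice A) : p ≤ q ↔ q.flat ≤ p.flat := Iff.rfl

open Classical in
noncomputable instance : Fintype (IntersectionLattice A) :=
  Fintype.ofSurjective
    (fun B : A.powerset => (⟨OrderDual.toDual (sInf ((B : Finset (AffineSubspace ℝ V)) :
        Set (AffineSubspace ℝ V))), B.1, Finset.mem_powerset.1 B.2, rfl⟩ : IntersectionLattice A))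
    (fun p => by
      obtain ⟨_, B, hB, rfl⟩ := p
      exact ⟨⟨B, Finset.mem_powerset.2 hB⟩, rfl⟩)

/-- The intersection of a family of intersections of `A` is again one. -/
theorem exists_sInf_flat (s : Set (IntersectionLattice A)) :
    ∃ B ⊆ A, OrderDual.toDual (sInf (flat '' s)) =
      OrderDual.toDual (sInf (B : Set (AffineSubspace ℝ V))) := by
  classical
  refine ⟨A.filter (fun H => ∃ p ∈ s, p.flat ≤ H), Finset.filter_subset _ _, ?_⟩
  congr 1
  apply le_antisymm
  · refine le_sInf fun H hH => ?_
    obtain ⟨-, p, hp, hpH⟩ := Finset.mem_filter.1 (Finset.mem_coe.1 hH)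
    exact (sInf_le (Set.mem_image_of_mem flat hp)).trans hpH
  · refine le_sInf ?_
    rintro _ ⟨p, hp, rfl⟩
    obtain ⟨B, hB, hpB⟩ := p.2
    have hflat : p.flat = sInf (B : Set (AffineSubspace ℝ V)) := congrArg OrderDual.ofDual hpB
    rw [hflat]
    refine le_sInf fun H hH => sInf_le ?_
    refine Finset.mem_coe.2 (Finset.mem_filter.2 ⟨hB hH, p, hp, ?_⟩)
    rw [hflat]
    exact sInf_le hH

/-- Joins in the intersection lattice are intersections of affine subspaces. -/
noncomputable instance : SupSet (IntersectionLattice A) where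
  sSup s := ⟨OrderDual.toDual (sInf (flat '' s)), exists_sInf_flat s⟩

noncomputable instance : CompleteLattice (IntersectionLattice A) :=
  completeLatticeOfSup _ fun s => by
    constructor
    · intro p hp
      exact sInf_le (Set.mem_image_of_mem flat hp : p.flat ∈ flat '' s)
    · intro q hq
      refine le_sInf (s := flat '' s) (a := q.flat) ?_
      rintro _ ⟨p, hp, rfl⟩
      exact hq hp

/-- The stratum `S_p = M_p \ ⋃_{q > p} M_q`. -/
def stratum (p : IntersectionLattice A) : Set V :=
  (p.flat : Set V) \ ⋃ q : {q : IntersectionLattice A // p < q}, (q.1.flat : Set V)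

end IntersectionLattice

/-- A face of `A` is a connected component of some stratum `S_p`. -/
def IsFace [TopologicalSpace V] (A : Finset (AffineSubspace ℝ V)) (F : Set V) : Prop :=
  ∃ p : IntersectionLattice A, ∃ x ∈ p.stratum, F = connectedComponentIn p.stratum x

/-- The set of `k`-faces of `A`: the faces whose affine span has dimension `k`. -/
def faces [TopologicalSpace V] (A : Finset (AffineSubspace ℝ V)) (k : ℕ) : Set (Set V) :=
  {F | IsFace A F ∧ finrank ℝ (affineSpan ℝ F).direction = k}

end

end HyperplaneArrangement

/-!
For each `p` in the intersection lattice, the components of the stratum `S_p` are the regions of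
the arrangement which `A` induces on `M_p`. They are relatively open in `M_p`
(`direction_affineSpan_of_mem_components`), and `dim M_p = d - r(p)` (`height_add_finrank_dir`), so
the `k`-faces are the components of the strata `S_p` with `r(p) = d - k`. It remains to see that
`S_p` has `dim A([p, 1])` components (`components_and_osAlgebra`). Both numbers are compared with
the number of sets of atoms of `[p, 1]` without broken circuits, for any ordering of the atoms.
Such a set `T` is described by the condition that no atom `a` lies below the join of the elements
of `T` coming after `a`.

The monomials of these sets form a basis of the Orlik–Solomon algebra of a lattice in which the
join of `n` atoms has rank at most `n` (`nbcBasis`). They span, since the relation of a broken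
circuit replaces an atom of a monomial by an earlier one (`proj_wordProd_mem_span`). For linear
independence, the joins of the final segments of a set `S` without broken circuits form a chain,
and sending `e_a` to a basis vector numbered by the position of `a` with respect to this chain
defines a homomorphism to an exterior algebra. Since atoms at distinct positions are independent
(`not_isDependent_of_injOn_level`), the monomial of a dependent set is mapped to zero, and the
homomorphism factors through the Orlik–Solomon algebra (`levelHom_eq_zero`). The coefficient
functionals obtained in this way are dual to the monomials (`coeff_levelHom_wordProd`).

Regions are encoded by the signs of the functionals defining the hyperplanes
(`mem_connectedComponentIn_iff`). The number of realized sign patterns and the number of sets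
without broken circuits satisfy the same deletion–restriction recursion when the last functional is
removed (`ncard_signSets_insert`, `ncard_nbcSets_insert`), hence agree
(`ncard_signSets_eq_ncard_nbcSets`).
-/

namespace OrlikSolomon

/-! ### Words in the generators of the Orlik–Solomon algebra -/

section Words

variable {K : Type*} [Field K] {L : Type*} [Lattice L] [OrderBot L]

variable (K) in
/-- The product `e_{a_1} ⋯ e_{a_n}` in `E(L)` of the generators named by a word of atoms; letters
may be repeated. -/
noncomputable def wordProd (l : List (Atom L)) : Ext K L :=
  (l.map fun a => ExteriorAlgebra.ι K (Finsupp.single a (1 : K))).prod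

theorem wordProd_cons (a : Atom L) (l : List (Atom L)) :
    wordProd K (a :: l) = ExteriorAlgebra.ι K (Finsupp.single a (1 : K)) * wordProd K l := by
  simp [wordProd]

theorem wordProd_append (l₁ l₂ : List (Atom L)) :
    wordProd K (l₁ ++ l₂) = wordProd K l₁ * wordProd K l₂ := by
  simp [wordProd]

theorem monomial_get (l : List (Atom L)) : monomial K L l.get = wordProd K l := by
  rw [monomial, ExteriorAlgebra.ιMulti_apply, wordProd]
  congr 1
  conv_rhs => rw [← List.ofFn_get l, List.map_ofFn]
  rfl

theorem wordProd_eq_zero {l : List (Atom L)} (h : ¬ l.Nodup) : wordProd K l = 0 := by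
  rw [← monomial_get, monomial]
  apply AlternatingMap.map_eq_zero_of_not_injective
  intro hinj
  exact h (List.nodup_iff_injective_get.2 fun i j hij => hinj (by simp only [hij]))

/-- Reordering a word changes its product by a sign only. -/
theorem wordProd_perm {l₁ l₂ : List (Atom L)} (h : l₁.Perm l₂) :
    wordProd K l₁ = wordProd K l₂ ∨ wordProd K l₁ = -wordProd K l₂ := by
  induction h with
  | nil => exact Or.inl rfl
  | cons a _ ih =>
    rw [wordProd_cons, wordProd_cons]
    rcases ih with h | h <;> simp [h]
  | swap a b l =>
    right
    simp only [wordProd_cons, ← mul_assoc]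
    rw [← neg_mul]
    congr 1
    exact eq_neg_of_add_eq_zero_left (ExteriorAlgebra.ι_add_mul_swap _ _)
  | trans _ _ ih₁ ih₂ =>
    rcases ih₁ with h | h <;> rcases ih₂ with h' | h' <;> simp [h, h']

theorem wordProd_mem_of_perm {S : Type*} [AddCommGroup S] [Module K S] (f : Ext K L →ₗ[K] S)
    (N : Submodule K S) {l₁ l₂ : List (Atom L)} (h : l₁.Perm l₂) (hN : f (wordProd K l₁) ∈ N) :
    f (wordProd K l₂) ∈ N := by
  rcases wordProd_perm (K := K) h.symm with h | h <;> rw [h]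
  · exact hN
  · rw [map_neg]
    exact neg_mem hN

theorem boundary_wordProd_cons (a : Atom L) (l : List (Atom L)) :
    boundary K L (wordProd K (a :: l)) = wordProd K l -
      ExteriorAlgebra.ι K (Finsupp.single a (1 : K)) * boundary K L (wordProd K l) := by
  rw [wordProd_cons]
  refine (CliffordAlgebra.contractLeft_ι_mul _ _ _).trans ?_
  rw [Finsupp.linearCombination_single, smul_eq_mul, one_mul, one_smul]
  rfl

/-- `∂` of a word is a combination of the words with one letter removed. -/
theorem boundary_wordProd_mem_span (l : List (Atom L)) :
    boundary K L (wordProd K l) ∈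
      Submodule.span K (wordProd K '' {l' | ∃ s, (s :: l').Perm l}) := by
  induction l with
  | nil =>
    have h : boundary K L (wordProd K []) = 0 := boundary_monomial_zero K L Fin.elim0
    rw [h]
    exact zero_mem _
  | cons a l ih =>
    rw [boundary_wordProd_cons]
    refine sub_mem (Submodule.subset_span ⟨l, ⟨a, .refl _⟩, rfl⟩) ?_
    have := Submodule.mem_map_of_mem
      (f := LinearMap.mulLeft K (ExteriorAlgebra.ι K (Finsupp.single a (1 : K)))) ih
    rw [Submodule.map_span] at this
    refine Submodule.span_mono ?_ this
    rintro _ ⟨_, ⟨l', ⟨s, hs⟩, rfl⟩, rfl⟩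
    refine ⟨a :: l', ⟨s, (List.Perm.swap a s l').trans (hs.cons a)⟩, ?_⟩
    rw [wordProd_cons]
    rfl

variable (K L) in
theorem span_range_wordProd :
    Submodule.span K (Set.range (wordProd K : List (Atom L) → Ext K L)) = ⊤ := by
  rw [eq_top_iff]
  rintro x -
  induction x using CliffordAlgebra.left_induction with
  | algebraMap r =>
    rw [Algebra.algebraMap_eq_smul_one]
    exact Submodule.smul_mem _ _ (Submodule.subset_span ⟨[], rfl⟩)
  | add x y hx hy => exact add_mem hx hy
  | ι_mul x m hx =>
    induction m using Finsupp.induction_linear with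
    | zero => simp
    | add f g hf hg =>
      rw [map_add, add_mul]
      exact add_mem hf hg
    | single a c =>
      have hc : Finsupp.single a c = c • Finsupp.single a (1 : K) := by simp
      rw [hc, map_smul, smul_mul_assoc]
      refine Submodule.smul_mem _ _ ?_
      have := Submodule.mem_map_of_mem
        (f := LinearMap.mulLeft K (ExteriorAlgebra.ι K (Finsupp.single a (1 : K)))) hx
      rw [Submodule.map_span] at this
      refine Submodule.span_mono ?_ this
      rintro _ ⟨_, ⟨l, rfl⟩, rfl⟩
      exact ⟨a :: l, wordProd_cons a l⟩

variable (K L) in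
/-- The projection `E(L) → A(L)`. -/
noncomputable def proj : Ext K L →ₐ[K] OSAlgebra K L := (ideal K L).ringCon.mkₐ K

theorem proj_eq_zero_iff {x : Ext K L} : proj K L x = 0 ↔ x ∈ ideal K L := by
  rw [TwoSidedIdeal.mem_iff, ← RingCon.eq]
  rfl

theorem proj_boundary_wordProd [DecidableEq (Atom L)] {l : List (Atom L)} (hl : l.Nodup)
    (h : IsDependent l.toFinset) : proj K L (boundary K L (wordProd K l)) = 0 := by
  rw [proj_eq_zero_iff, ← monomial_get]
  refine TwoSidedIdeal.subset_span
    ⟨_, ⟨l.get, fun i j hij => (List.nodup_iff_injective_get.1 hl) hij⟩, ?_, rfl⟩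
  convert h
  ext a
  simp only [Finset.mem_map, Finset.mem_univ, true_and, List.mem_toFinset, List.mem_iff_get]
  rfl

end Words

/-! ### Sets without broken circuits -/

section NBC

variable {L : Type*} [Lattice L] [OrderBot L]

/-- The sets of atoms containing no broken circuit with respect to the ordering of the atoms by
`rk`: no atom `a` lies below the join of the elements of `T` which come after it. -/
def IsNBC (rk : Atom L → ℕ) (T : Finset (Atom L)) : Prop :=
  ∀ a : Atom L, ¬ (a : L) ≤ (T.filter (rk a < rk ·)).sup Subtype.val

/-- A set of atoms is independent if in some ordering none of its elements lies below the join
of the later ones. -/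
theorem card_le_height_sup (ℓ : Atom L → ℕ) (T : Finset (Atom L)) (hinj : Set.InjOn ℓ T)
    (h : ∀ a ∈ T, ¬ (a : L) ≤ (T.filter (ℓ a < ℓ ·)).sup Subtype.val) :
    (T.card : ℕ∞) ≤ Order.height (T.sup Subtype.val) := by
  classical
  induction T using Finset.induction_on_min_value ℓ with
  | empty => simp
  | insert a s ha hmin ih =>
    have hlt : ∀ x ∈ s, ℓ a < ℓ x := fun x hx => lt_of_le_of_ne (hmin x hx) fun he => ha <| by
      rwa [hinj (by simp) (by simp [hx]) he]
    have ih' := ih (hinj.mono (by simp)) fun b hb hle => h b (by simp [hb]) <|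
      hle.trans <| Finset.sup_mono <| Finset.filter_subset_filter _ (Finset.subset_insert _ _)
    rw [Finset.card_insert_of_notMem ha, Nat.cast_add, Nat.cast_one]
    refine (add_le_add_left ih' 1).trans (Order.height_add_one_le ?_)
    rw [Finset.sup_insert]
    refine lt_of_le_of_ne le_sup_right fun he => h a (by simp) ?_
    have hale : (a : L) ≤ s.sup Subtype.val := le_sup_left.trans he.ge
    refine hale.trans (Finset.sup_mono fun x hx => ?_)
    simp [hx, hlt x hx]

open Classical in
/-- The position of an atom with respect to the chain of the joins of the final segments of `S`:
`rk s + 1` for the last `s ∈ S` such that the atom lies below the join of the elements of `S`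
from `s` on, and `0` if there is none. -/
noncomputable def level (rk : Atom L → ℕ) (S : Finset (Atom L)) (a : Atom L) : ℕ :=
  S.sup fun s => if (a : L) ≤ (S.filter (rk s ≤ rk ·)).sup Subtype.val then rk s + 1 else 0

variable {rk : Atom L → ℕ} {S : Finset (Atom L)}

theorem rk_lt_level_iff {s : Atom L} (hs : s ∈ S) (a : Atom L) :
    rk s < level rk S a ↔ (a : L) ≤ (S.filter (rk s ≤ rk ·)).sup Subtype.val := by
  classical
  rw [level, Finset.lt_sup_iff]
  constructor
  · rintro ⟨t, ht, hlt⟩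
    split_ifs at hlt with h
    · refine h.trans (Finset.sup_mono fun x hx => ?_)
      simp only [Finset.mem_filter] at hx ⊢
      exact ⟨hx.1, by omega⟩
    · omega
  · intro h
    exact ⟨s, hs, by simp [h]⟩

theorem exists_level_eq {a : Atom L} (h : 0 < level rk S a) : ∃ s ∈ S, level rk S a = rk s + 1 := by
  classical
  have hne : S.Nonempty := by
    rw [Finset.nonempty_iff_ne_empty]
    rintro rfl
    simp [level] at h
  obtain ⟨s, hs, he⟩ := Finset.exists_mem_eq_sup S hne
    (fun s => if (a : L) ≤ (S.filter (rk s ≤ rk ·)).sup Subtype.val then rk s + 1 else 0)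
  rw [level] at h ⊢
  refine ⟨s, hs, ?_⟩
  rw [he] at h ⊢
  split_ifs at h ⊢ with h'
  · rfl
  · omega

/-- No atom lies below a join of atoms of higher level, because that join lies below the member of
the chain which the lowest of these levels stands for. -/
theorem not_le_sup_level (T : Finset (Atom L)) (a : Atom L) :
    ¬ (a : L) ≤ (T.filter (level rk S a < level rk S ·)).sup Subtype.val := by
  intro hle
  rcases (T.filter (level rk S a < level rk S ·)).eq_empty_or_nonempty with he | hne
  · rw [he, Finset.sup_empty, le_bot_iff] at hle
    exact a.2.1 hle
  obtain ⟨t, ht, hmin⟩ := Finset.exists_min_image _ (level rk S) hne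
  have ht' := (Finset.mem_filter.1 ht).2
  obtain ⟨s, hs, hst⟩ := exists_level_eq (Nat.zero_lt_of_lt ht')
  have : rk s < level rk S a := by
    rw [rk_lt_level_iff hs]
    refine hle.trans (Finset.sup_le fun x hx => ?_)
    rw [← rk_lt_level_iff hs]
    have := hmin x hx
    omega
  omega

/-- Atoms at distinct levels are independent. -/
theorem not_isDependent_of_injOn_level {T : Finset (Atom L)} (h : Set.InjOn (level rk S) T) :
    ¬ IsDependent T :=
  not_lt.2 <| card_le_height_sup _ T h fun a _ => not_le_sup_level T a

theorem IsNBC.level_eq (hS : IsNBC rk S) {s : Atom L} (hs : s ∈ S) : level rk S s = rk s + 1 := by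
  have h1 : rk s < level rk S s := (rk_lt_level_iff hs s).2 <|
    Finset.le_sup (f := Subtype.val) (by simp [hs])
  refine le_antisymm ?_ h1
  by_contra! hlt
  obtain ⟨t, ht, hst⟩ := exists_level_eq (Nat.zero_lt_of_lt h1)
  have hle : rk t < level rk S s := by omega
  refine hS s (((rk_lt_level_iff ht s).1 hle).trans (Finset.sup_mono fun x hx => ?_))
  simp only [Finset.mem_filter] at hx ⊢
  exact ⟨hx.1, by omega⟩

/-- A set without broken circuits is determined by its levels with respect to another one: the
joins of the final segments of `S` are joins of subsets of `T`, so that their first atoms, the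
elements of `S`, lie in `T`. -/
theorem IsNBC.subset_of_level (hrk : rk.Injective)
    (hL : ∀ U : Finset (Atom L), Order.height (U.sup Subtype.val) ≤ (U.card : ℕ∞))
    (hS : IsNBC rk S) {T : Finset (Atom L)} (hT : IsNBC rk T) (hinj : Set.InjOn (level rk S) T)
    (hsurj : ∀ s ∈ S, ∃ t ∈ T, level rk S t = rk s + 1) : S ⊆ T := by
  classical
  intro s hs
  set S' := S.filter (rk s ≤ rk ·) with hS'
  set T' := T.filter (rk s < level rk S ·) with hT'
  have hle : T'.sup Subtype.val ≤ S'.sup Subtype.val := Finset.sup_le fun t ht =>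
    (rk_lt_level_iff hs t).1 (Finset.mem_filter.1 ht).2
  have hcard : S'.card ≤ T'.card := by
    have hinj' : Set.InjOn (fun s => rk s + 1) (S' : Set (Atom L)) := fun x _ y _ hxy =>
      hrk (Nat.succ_injective hxy)
    rw [← Finset.card_image_of_injOn hinj']
    refine (Finset.card_le_card ?_).trans (Finset.card_image_le (f := level rk S) (s := T'))
    intro n hn
    obtain ⟨x, hx, rfl⟩ := Finset.mem_image.1 hn
    obtain ⟨hxS, hxs⟩ := Finset.mem_filter.1 hx
    obtain ⟨t, ht, hlt⟩ := hsurj x hxS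
    exact Finset.mem_image.2 ⟨t, Finset.mem_filter.2 ⟨ht, by omega⟩, hlt⟩
  have hT'h : (T'.card : ℕ∞) ≤ Order.height (T'.sup Subtype.val) :=
    card_le_height_sup _ T' (hinj.mono (Finset.coe_subset.2 (Finset.filter_subset _ _)))
      fun a _ => not_le_sup_level T' a
  have heq : T'.sup Subtype.val = S'.sup Subtype.val := by
    by_contra hne
    have h1 := Order.height_add_one_le (lt_of_le_of_ne hle hne)
    have h2 := (add_le_add_left hT'h 1).trans (h1.trans (hL S'))
    have h3 : T'.card + 1 ≤ S'.card := by exact_mod_cast h2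
    omega
  have hsT : (s : L) ≤ T'.sup Subtype.val := heq ▸ Finset.le_sup (f := Subtype.val) (by simp [hS', hs])
  have : ∃ t ∈ T', rk t ≤ rk s := by
    by_contra! hlt
    refine hT s (hsT.trans (Finset.sup_mono fun x hx => ?_))
    exact Finset.mem_filter.2 ⟨(Finset.mem_filter.1 hx).1, hlt x hx⟩
  obtain ⟨t, ht, hts⟩ := this
  obtain ⟨htT, htl⟩ := Finset.mem_filter.1 ht
  have : rk t = rk s := by
    refine le_antisymm hts (not_lt.1 fun hlt => ?_)
    refine hS t (((rk_lt_level_iff hs t).1 htl).trans (Finset.sup_mono fun x hx => ?_))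
    simp only [Finset.mem_filter] at hx ⊢
    exact ⟨hx.1, by omega⟩
  rwa [← hrk this]

end NBC

/-! ### The basis of the Orlik–Solomon algebra -/

section Basis

variable {K : Type*} [Field K] {L : Type*} [Lattice L] [OrderBot L] {rk : Atom L → ℕ}

/-- Rewriting a word by the relation of a broken circuit replaces a letter by an earlier one. -/
theorem proj_wordProd_mem_span
    (hL : ∀ U : Finset (Atom L), Order.height (U.sup Subtype.val) ≤ (U.card : ℕ∞))
    (l : List (Atom L)) :
    proj K L (wordProd K l) ∈ Submodule.span K
      (Set.range fun T : {T : Finset (Atom L) // IsNBC rk T} =>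
        proj K L (wordProd K T.1.toList)) := by
  classical
  induction hn : (l.map rk).sum using Nat.strong_induction_on generalizing l with
  | _ n ih =>
  subst hn
  set N := Submodule.span K (Set.range fun T : {T : Finset (Atom L) // IsNBC rk T} =>
        proj K L (wordProd K T.1.toList)) with hN
  by_cases hl : l.Nodup
  swap
  · rw [wordProd_eq_zero hl, map_zero]
    exact zero_mem _
  by_cases hnbc : IsNBC rk l.toFinset
  · refine wordProd_mem_of_perm (proj K L).toLinearMap N (l₁ := l.toFinset.toList) ?_
      (Submodule.subset_span ⟨⟨_, hnbc⟩, rfl⟩)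
    exact (List.toFinset_toList hl)
  obtain ⟨a, ha⟩ : ∃ a : Atom L,
      (a : L) ≤ (l.toFinset.filter (rk a < rk ·)).sup Subtype.val := by
    simpa [IsNBC] using hnbc
  set l₁ := l.filter (fun x => !decide (rk a < rk x)) with hl₁
  set l₂ := l.filter (fun x => decide (rk a < rk x)) with hl₂
  have hl₂mem : ∀ x ∈ l₂, rk a < rk x := fun x hx => by simpa using (List.mem_filter.1 hx).2
  have hperm : (l₂ ++ l₁).Perm l := List.filter_append_perm _ l
  refine wordProd_mem_of_perm (proj K L).toLinearMap N
    (List.perm_append_comm.trans hperm : (l₁ ++ l₂).Perm l) ?_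
  have hnd : (a :: l₂).Nodup :=
    List.nodup_cons.2 ⟨fun h => lt_irrefl _ (hl₂mem a h), hl.filter _⟩
  have hfin : l.toFinset.filter (rk a < rk ·) = l₂.toFinset := by
    ext x
    simp [hl₂]
  rw [hfin] at ha
  have hdep : IsDependent (a :: l₂).toFinset := by
    rw [IsDependent, List.toFinset_cons, Finset.sup_insert, sup_eq_right.2 ha,
      Finset.card_insert_of_notMem (by simpa using (List.nodup_cons.1 hnd).1)]
    refine (hL _).trans_lt ?_
    exact_mod_cast Nat.lt_succ_self _
  -- As `∂ (e_a w) = w - e_a ∂ w`, the relation replaces `w` by `e_a ∂ w`.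
  have hrel := proj_boundary_wordProd (K := K) hnd hdep
  rw [boundary_wordProd_cons, map_sub, sub_eq_zero] at hrel
  change proj K L (wordProd K (l₁ ++ l₂)) ∈ N
  rw [wordProd_append, map_mul, hrel, ← map_mul]
  have hmem := Submodule.mem_map_of_mem (f := (proj K L).toLinearMap ∘ₗ
    LinearMap.mulLeft K (wordProd K l₁ * ExteriorAlgebra.ι K (Finsupp.single a (1 : K))))
    (boundary_wordProd_mem_span (K := K) l₂)
  rw [Submodule.map_span] at hmem
  have hsub : ∀ x ∈ ((proj K L).toLinearMap ∘ₗ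
      LinearMap.mulLeft K (wordProd K l₁ * ExteriorAlgebra.ι K (Finsupp.single a (1 : K)))) ''
        (wordProd K '' {l' | ∃ s, (s :: l').Perm l₂}), x ∈ N := by
    rintro _ ⟨_, ⟨l', ⟨s, hs⟩, rfl⟩, rfl⟩
    have hw : wordProd K l₁ * ExteriorAlgebra.ι K (Finsupp.single a (1 : K)) * wordProd K l' =
        wordProd K (l₁ ++ a :: l') := by
      rw [wordProd_append, wordProd_cons, mul_assoc]
    simp only [LinearMap.comp_apply, LinearMap.mulLeft_apply, AlgHom.toLinearMap_apply, hw]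
    refine ih _ ?_ _ rfl
    have hsa : rk a < rk s := hl₂mem s (hs.subset (by simp))
    have h1 := ((hs.map rk).sum_eq)
    have h2 := ((hperm.map rk).sum_eq)
    simp only [List.map_append, List.sum_append, List.map_cons, List.sum_cons] at h1 h2 ⊢
    omega
  have := Submodule.span_le.2 hsub hmem
  simpa [mul_assoc] using this

variable (K) in
/-- The homomorphism `E(L) → Λ(K^ℕ)` sending the generator `e_a` to the basis vector numbered by
the level of `a`. -/
noncomputable def levelHom (rk : Atom L → ℕ) (S : Finset (Atom L)) :
    Ext K L →ₐ[K] ExteriorAlgebra K (ℕ →₀ K) :=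
  ExteriorAlgebra.map (Finsupp.lmapDomain K K (level rk S))

theorem levelHom_monomial (S : Finset (Atom L)) {n : ℕ} (v : Fin n → Atom L) :
    levelHom K rk S (monomial K L v) =
      ExteriorAlgebra.ιMulti K n fun i => Finsupp.single (level rk S (v i)) (1 : K) := by
  rw [levelHom, monomial, ExteriorAlgebra.map_apply_ιMulti]
  congr 1
  ext1 i
  simp [Finsupp.lmapDomain_apply, Finsupp.mapDomain_single]

/-- The homomorphism given by the levels commutes with the derivations which take the value `1`
on all generators. -/
theorem levelHom_boundary (S : Finset (Atom L)) (x : Ext K L) :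
    levelHom K rk S (boundary K L x) =
      CliffordAlgebra.contractLeft (Q := (0 : QuadraticForm K (ℕ →₀ K)))
        (Finsupp.linearCombination K (fun _ : ℕ => (1 : K))) (levelHom K rk S x) := by
  induction x using CliffordAlgebra.left_induction with
  | algebraMap r =>
    rw [boundary, CliffordAlgebra.contractLeft_algebraMap, map_zero, AlgHom.commutes]
    exact (CliffordAlgebra.contractLeft_algebraMap _ _ _).symm
  | add x y hx hy => simp only [map_add, hx, hy]
  | ι_mul x m hx =>
    rw [boundary, CliffordAlgebra.contractLeft_ι_mul, map_sub, map_mul, map_mul, map_smul]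
    change _ - _ * levelHom K rk S (boundary K L x) = _
    rw [hx]
    have hm : levelHom K rk S (CliffordAlgebra.ι 0 m) =
        CliffordAlgebra.ι 0 (Finsupp.mapDomain (level rk S) m) :=
      ExteriorAlgebra.map_apply_ι _ m
    rw [hm]
    refine Eq.trans ?_ (CliffordAlgebra.contractLeft_ι_mul _ _ _).symm
    congr 2
    rw [Finsupp.linearCombination_mapDomain]
    rfl

/-- The homomorphism given by the levels factors through `A(L)`: the atoms of a dependent set do
not have distinct levels, so that its monomial is mapped to zero. -/
theorem levelHom_eq_zero (S : Finset (Atom L)) {x : Ext K L} (hx : x ∈ ideal K L) :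
    levelHom K rk S x = 0 := by
  have : ideal K L ≤ TwoSidedIdeal.ker (levelHom K rk S) := by
    rw [ideal, TwoSidedIdeal.span_le]
    rintro _ ⟨n, v, hv, rfl⟩
    rw [SetLike.mem_coe, TwoSidedIdeal.mem_ker, levelHom_boundary, levelHom_monomial,
      AlternatingMap.map_eq_zero_of_not_injective, map_zero]
    intro hinj
    refine not_isDependent_of_injOn_level (rk := rk) (S := S) ?_ hv
    rintro a ha b hb hab
    simp only [Finset.coe_map, Finset.coe_univ, Set.image_univ, Set.mem_range] at ha hb
    obtain ⟨i, rfl⟩ := ha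
    obtain ⟨j, rfl⟩ := hb
    exact congrArg v (hinj (by simp only [hab]))
  exact (TwoSidedIdeal.mem_ker _).1 (this hx)

variable (K) in
/-- The coefficient of `b_{c 0} ∧ ⋯ ∧ b_{c (n-1)}` in an element of `Λ(K^ℕ)`. -/
noncomputable def coeff {n : ℕ} (c : Fin n → ℕ) : ExteriorAlgebra K (ℕ →₀ K) →ₗ[K] K :=
  ExteriorAlgebra.liftAlternating (Pi.single n
    ((Matrix.detRowAlternating (R := K) (n := Fin n)).compLinearMap
      (LinearMap.pi fun j => Finsupp.lapply (c j))))

theorem coeff_ιMulti {n : ℕ} (c b : Fin n → ℕ) :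
    coeff K c (ExteriorAlgebra.ιMulti K n fun i => Finsupp.single (b i) (1 : K)) =
      Matrix.det (Matrix.of fun i j => if b i = c j then (1 : K) else 0) := by
  rw [coeff, ExteriorAlgebra.liftAlternating_apply_ιMulti, Pi.single_eq_same,
    AlternatingMap.compLinearMap_apply]
  change Matrix.det _ = _
  congr 1
  ext i j
  simp [Finsupp.single_apply]

theorem coeff_ιMulti_of_ne {m n : ℕ} (h : m ≠ n) (c : Fin n → ℕ) (v : Fin m → ℕ →₀ K) :
    coeff K c (ExteriorAlgebra.ιMulti K m v) = 0 := by
  rw [coeff, ExteriorAlgebra.liftAlternating_apply_ιMulti, Pi.single_eq_of_ne h]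
  rfl

theorem exists_eq_of_coeff_ne_zero {m n : ℕ} {c : Fin n → ℕ} {b : Fin m → ℕ}
    (h : coeff K c (ExteriorAlgebra.ιMulti K m fun i => Finsupp.single (b i) (1 : K)) ≠ 0) :
    m = n ∧ b.Injective ∧ ∀ j, ∃ i, b i = c j := by
  have hmn : m = n := by
    by_contra hne
    exact h (coeff_ιMulti_of_ne hne _ _)
  subst hmn
  refine ⟨rfl, ?_, fun j => ?_⟩
  · by_contra hinj
    refine h ?_
    rw [AlternatingMap.map_eq_zero_of_not_injective, map_zero]
    intro h'
    exact hinj fun i j hij => h' (by simp only [hij])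
  · by_contra! hne
    refine h ?_
    rw [coeff_ιMulti]
    exact Matrix.det_eq_zero_of_column_eq_zero j fun i => by simp [hne i]

/-- The coefficient of `e_S` in the image of `e_T` under the homomorphism given by the levels with
respect to `S`, for `S` and `T` without broken circuits, is `1` or `0`. -/
theorem coeff_levelHom_wordProd (hrk : rk.Injective)
    (hL : ∀ U : Finset (Atom L), Order.height (U.sup Subtype.val) ≤ (U.card : ℕ∞))
    {S T : Finset (Atom L)} (hS : IsNBC rk S) (hT : IsNBC rk T) [Decidable (T = S)] :
    coeff K (fun j => rk (S.toList.get j) + 1) (levelHom K rk S (wordProd K T.toList)) =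
      if T = S then 1 else 0 := by
  rw [← monomial_get, levelHom_monomial]
  split_ifs with h
  · subst h
    have hlev : ∀ i, level rk T (T.toList.get i) = rk (T.toList.get i) + 1 := fun i =>
      hS.level_eq (Finset.mem_toList.1 (List.get_mem _ _))
    simp only [hlev]
    rw [coeff_ιMulti]
    convert Matrix.det_one (R := K) (n := Fin T.toList.length) using 2
    ext i j
    have hinj := List.nodup_iff_injective_get.1 T.nodup_toList
    simp only [Matrix.of_apply, Matrix.one_apply, Nat.add_right_cancel_iff, hrk.eq_iff, hinj.eq_iff]
  · by_contra hne
    obtain ⟨hcard, hinj, hsurj⟩ := exists_eq_of_coeff_ne_zero hne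
    rw [Finset.length_toList, Finset.length_toList] at hcard
    refine h (Finset.eq_of_subset_of_card_le (hS.subset_of_level hrk hL hT ?_ ?_) hcard.le).symm
    · intro a ha b hb hab
      obtain ⟨i, rfl⟩ := List.mem_iff_get.1 (Finset.mem_toList.2 ha)
      obtain ⟨j, rfl⟩ := List.mem_iff_get.1 (Finset.mem_toList.2 hb)
      rw [hinj hab]
    · intro s hs
      obtain ⟨j, rfl⟩ := List.mem_iff_get.1 (Finset.mem_toList.2 hs)
      obtain ⟨i, hi⟩ := hsurj j
      exact ⟨_, Finset.mem_toList.1 (List.get_mem _ i), hi⟩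

/-- The functionals `coeff ∘ levelHom` attached to the sets `S` without broken circuits form a dual
family of the monomials. -/
theorem linearIndependent_proj_wordProd (hrk : rk.Injective)
    (hL : ∀ U : Finset (Atom L), Order.height (U.sup Subtype.val) ≤ (U.card : ℕ∞)) :
    LinearIndependent K fun T : {T : Finset (Atom L) // IsNBC rk T} =>
      proj K L (wordProd K T.1.toList) := by
  classical
  rw [linearIndependent_iff']
  intro s c hc S hS
  have hmem : ∑ T ∈ s, c T • wordProd K T.1.toList ∈ ideal K L := by
    rw [← proj_eq_zero_iff, map_sum, ← hc]
    exact Finset.sum_congr rfl fun T _ => map_smul _ _ _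
  have h := congrArg (coeff K (fun j => rk (S.1.toList.get j) + 1))
    (levelHom_eq_zero (rk := rk) S.1 hmem)
  rw [map_sum, map_sum, map_zero] at h
  simp only [map_smul, coeff_levelHom_wordProd hrk hL S.2 (Subtype.prop _), smul_eq_mul,
    mul_ite, mul_one, mul_zero, ← Subtype.ext_iff] at h
  simpa [hS] using h

variable (K) in
/-- The monomials of the sets without broken circuits form a basis of the Orlik–Solomon
algebra. -/
noncomputable def nbcBasis (hrk : rk.Injective)
    (hL : ∀ U : Finset (Atom L), Order.height (U.sup Subtype.val) ≤ (U.card : ℕ∞)) :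
    Basis {T : Finset (Atom L) // IsNBC rk T} K (OSAlgebra K L) :=
  Basis.mk (linearIndependent_proj_wordProd hrk hL) <| by
    have h : Submodule.map (proj K L).toLinearMap
        (Submodule.span K (Set.range (wordProd K : List (Atom L) → Ext K L))) = ⊤ := by
      rw [span_range_wordProd, Submodule.map_top, LinearMap.range_eq_top]
      exact RingCon.mkₐ_surjective (α := K) (ideal K L).ringCon
    rw [← h, Submodule.map_span, Submodule.span_le]
    rintro _ ⟨_, ⟨l, rfl⟩, rfl⟩
    exact proj_wordProd_mem_span hL l

end Basis

end OrlikSolomon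

namespace HyperplaneArrangement

/-! ### Regions of real arrangements -/

section SignSets

variable {V : Type*} [AddCommGroup V] [Module ℝ V] {ι : Type*}

/-- The regions of the arrangement of the hyperplanes `g i = 0`, `i ∈ s`, in the subspace `W`,
encoded by their sets of positive functionals. -/
def signSets (g : ι → Dual ℝ V) (s : Finset ι) (W : Submodule ℝ V) : Set (Finset ι) :=
  {P | P ⊆ s ∧ ∃ x ∈ W, ∀ i ∈ s, g i x ≠ 0 ∧ (i ∈ P ↔ 0 < g i x)}

/-- The subsets of `s` without broken circuits for the functionals `g i` restricted to `W`: no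
`g i` vanishes on the part of `W` where the functionals of `T` following it vanish. -/
def nbcSets (g : ι → Dual ℝ V) (rk : ι → ℕ) (s : Finset ι) (W : Submodule ℝ V) :
    Set (Finset ι) :=
  {T | T ⊆ s ∧ ∀ i ∈ s, ∃ x ∈ W, (∀ j ∈ T, rk i < rk j → g j x = 0) ∧ g i x ≠ 0}

theorem finite_signSets (g : ι → Dual ℝ V) (s : Finset ι) (W : Submodule ℝ V) :
    (signSets g s W).Finite :=
  s.powerset.finite_toSet.subset fun _ hP => Finset.mem_coe.2 (Finset.mem_powerset.2 hP.1)

theorem finite_nbcSets (g : ι → Dual ℝ V) (rk : ι → ℕ) (s : Finset ι) (W : Submodule ℝ V) :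
    (nbcSets g rk s W).Finite :=
  s.powerset.finite_toSet.subset fun _ hP => Finset.mem_coe.2 (Finset.mem_powerset.2 hP.1)

/-- A small displacement does not change the signs of finitely many nonzero values. -/
theorem eventually_forall_mul_pos (g : ι → Dual ℝ V) (s : Finset ι) {x : V}
    (hx : ∀ i ∈ s, g i x ≠ 0) (v : V) :
    ∀ᶠ t in nhds (0 : ℝ), ∀ i ∈ s, 0 < g i x * g i (x + t • v) := by
  rw [Filter.eventually_all_finset]
  intro i hi
  have hc : Continuous fun t : ℝ => g i x * g i (x + t • v) := by
    simp only [map_add, map_smul, smul_eq_mul]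
    fun_prop
  refine hc.continuousAt.eventually_const_lt ?_
  simpa using mul_self_pos.2 (hx i hi)

theorem exists_pos_forall_mul_pos (g : ι → Dual ℝ V) (s : Finset ι) {x : V}
    (hx : ∀ i ∈ s, g i x ≠ 0) (v : V) :
    ∃ t : ℝ, 0 < t ∧ ∀ i ∈ s, 0 < g i x * g i (x + t • v) := by
  obtain ⟨t, ht, h⟩ := (((eventually_forall_mul_pos g s hx v).filter_mono
    nhdsWithin_le_nhds).and (self_mem_nhdsWithin (s := Set.Ioi (0 : ℝ)))).exists
  exact ⟨t, h, ht⟩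

theorem ne_zero_and_iff_of_mul_pos {a b : ℝ} (h : 0 < a * b) {p : Prop} (hp : p ↔ 0 < a) :
    b ≠ 0 ∧ (p ↔ 0 < b) :=
  ⟨right_ne_zero_of_mul h.ne', hp.trans (pos_iff_pos_of_mul_pos h)⟩

theorem ncard_eq_add_of_insert [DecidableEq ι] {N : Set (Finset ι)} (hN : N.Finite) (m : ι) :
    N.ncard = {P | m ∉ P ∧ P ∈ N}.ncard + {P | m ∉ P ∧ insert m P ∈ N}.ncard := by
  have hinj : Set.InjOn (fun P => insert m P) {P : Finset ι | m ∉ P ∧ insert m P ∈ N} := by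
    intro P hP Q hQ h
    rw [← Finset.erase_insert hP.1, ← Finset.erase_insert hQ.1]
    exact congrArg (Finset.erase · m) h
  have hsub : (fun P => insert m P) '' {P : Finset ι | m ∉ P ∧ insert m P ∈ N} ⊆ N := by
    rintro _ ⟨P, hP, rfl⟩
    exact hP.2
  rw [← hinj.ncard_image, ← Set.ncard_union_eq _ (hN.subset fun P hP => hP.2)
    (hN.subset hsub)]
  · congr 1
    ext P
    constructor
    · intro hP
      by_cases hm : m ∈ P
      · right
        exact ⟨P.erase m, ⟨Finset.notMem_erase m P, by rwa [Finset.insert_erase hm]⟩,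
          Finset.insert_erase hm⟩
      · exact Or.inl ⟨hm, hP⟩
    · rintro (hP | hP)
      · exact hP.2
      · exact hsub hP
  · rw [Set.disjoint_left]
    rintro _ ⟨hP, -⟩ ⟨Q, -, rfl⟩
    exact hP (Finset.mem_insert_self m Q)

variable (g : ι → Dual ℝ V) {s : Finset ι} {W : Submodule ℝ V} {m : ι}

/-- Deletion and restriction for regions: adding the hyperplane `g m = 0` cuts the regions which
it meets into two. -/
theorem ncard_signSets_insert [DecidableEq ι] (hm : m ∉ s) {v : V} (hv : v ∈ W)
    (hgv : g m v ≠ 0) :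
    (signSets g (insert m s) W).ncard =
      (signSets g s W).ncard + (signSets g s (W ⊓ LinearMap.ker (g m))).ncard := by
  set N₀ : Set (Finset ι) := {P | m ∉ P ∧ P ∈ signSets g (insert m s) W} with hN₀
  set N₁ : Set (Finset ι) := {P | m ∉ P ∧ insert m P ∈ signSets g (insert m s) W} with hN₁
  have mem₀ : ∀ P, P ∈ N₀ ↔ P ⊆ s ∧ ∃ x ∈ W, g m x < 0 ∧
      ∀ i ∈ s, g i x ≠ 0 ∧ (i ∈ P ↔ 0 < g i x) := by
    intro P
    constructor
    · rintro ⟨hmP, hPs, x, hxW, hx⟩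
      refine ⟨(Finset.subset_insert_iff_of_notMem hmP).1 hPs, x, hxW, ?_, fun i hi =>
        hx i (Finset.mem_insert_of_mem hi)⟩
      obtain ⟨h1, h2⟩ := hx m (Finset.mem_insert_self m s)
      exact lt_of_le_of_ne (not_lt.1 fun h => hmP (h2.2 h)) h1
    · rintro ⟨hPs, x, hxW, hxm, hx⟩
      have hmP : m ∉ P := fun h => hm (hPs h)
      refine ⟨hmP, hPs.trans (Finset.subset_insert _ _), x, hxW, fun i hi => ?_⟩
      rcases Finset.mem_insert.1 hi with rfl | hi
      · exact ⟨hxm.ne, iff_of_false hmP hxm.not_gt⟩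
      · exact hx i hi
  have mem₁ : ∀ P, P ∈ N₁ ↔ P ⊆ s ∧ ∃ x ∈ W, 0 < g m x ∧
      ∀ i ∈ s, g i x ≠ 0 ∧ (i ∈ P ↔ 0 < g i x) := by
    intro P
    have hins : ∀ i ∈ s, (i ∈ insert m P ↔ i ∈ P) := fun i hi => by
      rw [Finset.mem_insert, or_iff_right]
      rintro rfl
      exact hm hi
    constructor
    · rintro ⟨hmP, hPs, x, hxW, hx⟩
      refine ⟨(Finset.insert_subset_insert_iff hmP).1 hPs, x, hxW,
        (hx m (Finset.mem_insert_self m s)).2.1 (Finset.mem_insert_self m P), fun i hi => ?_⟩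
      rw [← hins i hi]
      exact hx i (Finset.mem_insert_of_mem hi)
    · rintro ⟨hPs, x, hxW, hxm, hx⟩
      have hmP : m ∉ P := fun h => hm (hPs h)
      refine ⟨hmP, Finset.insert_subset_insert m hPs, x, hxW, fun i hi => ?_⟩
      rcases Finset.mem_insert.1 hi with rfl | hi
      · exact ⟨hxm.ne', iff_of_true (Finset.mem_insert_self _ P) hxm⟩
      · rw [hins i hi]
        exact hx i hi
  -- Points on the hyperplane can be moved to both of its sides.
  have move : ∀ P ⊆ s, ∀ x ∈ W, g m x = 0 → (∀ i ∈ s, g i x ≠ 0 ∧ (i ∈ P ↔ 0 < g i x)) →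
      P ∈ N₀ ∧ P ∈ N₁ := by
    intro P hPs x hxW hxm hx
    have key : ∀ w ∈ W, ∃ t : ℝ, 0 < t ∧ x + t • w ∈ W ∧ g m (x + t • w) = t * g m w ∧
        ∀ i ∈ s, g i (x + t • w) ≠ 0 ∧ (i ∈ P ↔ 0 < g i (x + t • w)) := by
      intro w hw
      obtain ⟨t, ht, h⟩ := exists_pos_forall_mul_pos g s (fun i hi => (hx i hi).1) w
      exact ⟨t, ht, add_mem hxW (W.smul_mem t hw), by simp [hxm], fun i hi =>
        ne_zero_and_iff_of_mul_pos (h i hi) (hx i hi).2⟩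
    obtain ⟨w, hw, hwm⟩ : ∃ w ∈ W, 0 < g m w := by
      rcases hgv.lt_or_gt with h | h
      · exact ⟨-v, neg_mem hv, by simpa using h⟩
      · exact ⟨v, hv, h⟩
    rw [mem₀, mem₁]
    constructor
    · obtain ⟨t, ht, h1, h2, h3⟩ := key (-w) (neg_mem hw)
      refine ⟨hPs, _, h1, ?_, h3⟩
      rw [h2, map_neg, mul_neg, neg_lt_zero]
      exact mul_pos ht hwm
    · obtain ⟨t, ht, h1, h2, h3⟩ := key w hw
      refine ⟨hPs, _, h1, ?_, h3⟩
      rw [h2]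
      exact mul_pos ht hwm
  have hunion : N₀ ∪ N₁ = signSets g s W := by
    ext P
    rw [Set.mem_union]
    constructor
    · rintro (h | h)
      · obtain ⟨hPs, x, hxW, -, hx⟩ := (mem₀ P).1 h
        exact ⟨hPs, x, hxW, hx⟩
      · obtain ⟨hPs, x, hxW, -, hx⟩ := (mem₁ P).1 h
        exact ⟨hPs, x, hxW, hx⟩
    · rintro ⟨hPs, x, hxW, hx⟩
      rcases lt_trichotomy (g m x) 0 with h | h | h
      · exact Or.inl ((mem₀ P).2 ⟨hPs, x, hxW, h, hx⟩)
      · exact Or.inl (move P hPs x hxW h hx).1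
      · exact Or.inr ((mem₁ P).2 ⟨hPs, x, hxW, h, hx⟩)
  have hinter : N₀ ∩ N₁ = signSets g s (W ⊓ LinearMap.ker (g m)) := by
    ext P
    rw [Set.mem_inter_iff]
    constructor
    · rintro ⟨h₀, h₁⟩
      obtain ⟨hPs, x, hxW, hxm, hx⟩ := (mem₀ P).1 h₀
      obtain ⟨-, y, hyW, hym, hy⟩ := (mem₁ P).1 h₁
      -- The segment from `x` to `y` stays in the region and meets the hyperplane.
      refine ⟨hPs, (g m y) • x + (-g m x) • y,
        ⟨add_mem (W.smul_mem _ hxW) (W.smul_mem _ hyW), ?_⟩, fun i hi => ?_⟩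
      · rw [SetLike.mem_coe, LinearMap.mem_ker]
        simp only [map_add, map_smul, smul_eq_mul]
        ring
      · obtain ⟨hx0, hxP⟩ := hx i hi
        obtain ⟨hy0, hyP⟩ := hy i hi
        have hxm' : 0 < -g m x := neg_pos.2 hxm
        simp only [map_add, map_smul, smul_eq_mul]
        by_cases hiP : i ∈ P
        · have := add_pos (mul_pos hym (hxP.1 hiP)) (mul_pos hxm' (hyP.1 hiP))
          exact ⟨this.ne', iff_of_true hiP this⟩
        · have hx' := lt_of_le_of_ne (not_lt.1 fun h => hiP (hxP.2 h)) hx0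
          have hy' := lt_of_le_of_ne (not_lt.1 fun h => hiP (hyP.2 h)) hy0
          have := add_neg (mul_neg_of_pos_of_neg hym hx') (mul_neg_of_pos_of_neg hxm' hy')
          exact ⟨this.ne, iff_of_false hiP this.not_gt⟩
    · rintro ⟨hPs, x, ⟨hxW, hxm⟩, hx⟩
      exact move P hPs x hxW (LinearMap.mem_ker.1 hxm) hx
  have hfin : (N₀ ∪ N₁).Finite := hunion ▸ finite_signSets g s W
  rw [ncard_eq_add_of_insert (finite_signSets _ _ _) m, ← hunion, ← hinter,
    Set.ncard_union_add_ncard_inter _ _ (hfin.subset Set.subset_union_left)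
      (hfin.subset Set.subset_union_right)]

/-- Deletion and restriction for sets without broken circuits, at the last functional. -/
theorem ncard_nbcSets_insert [DecidableEq ι] {rk : ι → ℕ} (hm : m ∉ s)
    (hlt : ∀ i ∈ s, rk i < rk m) {v : V} (hv : v ∈ W) (hgv : g m v ≠ 0) :
    (nbcSets g rk (insert m s) W).ncard =
      (nbcSets g rk s W).ncard + (nbcSets g rk s (W ⊓ LinearMap.ker (g m))).ncard := by
  have hnlt : ∀ T ⊆ s, ∀ j ∈ T, ¬ rk m < rk j := fun T hT j hj => (hlt j (hT hj)).not_gt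
  rw [ncard_eq_add_of_insert (finite_nbcSets _ _ _ _) m]
  congr 2
  · ext T
    constructor
    · rintro ⟨hmT, hTs, hT⟩
      exact ⟨(Finset.subset_insert_iff_of_notMem hmT).1 hTs, fun i hi =>
        hT i (Finset.mem_insert_of_mem hi)⟩
    · rintro ⟨hTs, hT⟩
      refine ⟨fun h => hm (hTs h), hTs.trans (Finset.subset_insert _ _), fun i hi => ?_⟩
      rcases Finset.mem_insert.1 hi with rfl | hi
      · exact ⟨v, hv, fun j hj h => absurd h (hnlt T hTs j hj), hgv⟩
      · exact hT i hi
  · ext T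
    constructor
    · rintro ⟨hmT, hTs, hT⟩
      refine ⟨(Finset.insert_subset_insert_iff hmT).1 hTs, fun i hi => ?_⟩
      obtain ⟨x, hxW, hx, hxi⟩ := hT i (Finset.mem_insert_of_mem hi)
      exact ⟨x, ⟨hxW, hx m (Finset.mem_insert_self m T) (hlt i hi)⟩, fun j hj h =>
        hx j (Finset.mem_insert_of_mem hj) h, hxi⟩
    · rintro ⟨hTs, hT⟩
      refine ⟨fun h => hm (hTs h), Finset.insert_subset_insert m hTs, fun i hi => ?_⟩
      rcases Finset.mem_insert.1 hi with rfl | hi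
      · refine ⟨v, hv, fun j hj h => ?_, hgv⟩
        rcases Finset.mem_insert.1 hj with rfl | hj
        · exact absurd h (lt_irrefl _)
        · exact absurd h (hnlt T hTs j hj)
      · obtain ⟨x, ⟨hxW, hxm⟩, hx, hxi⟩ := hT i hi
        refine ⟨x, hxW, fun j hj h => ?_, hxi⟩
        rcases Finset.mem_insert.1 hj with rfl | hj
        · exact hxm
        · exact hx j hj h

/-- A real arrangement has as many regions as there are sets without broken circuits. -/
theorem ncard_signSets_eq_ncard_nbcSets {rk : ι → ℕ} (hrk : rk.Injective) (s : Finset ι)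
    (W : Submodule ℝ V) : (signSets g s W).ncard = (nbcSets g rk s W).ncard := by
  classical
  induction s using Finset.induction_on_max_value rk generalizing W with
  | empty =>
    congr 1
    ext T
    exact ⟨fun h => ⟨h.1, by simp⟩, fun h => ⟨h.1, 0, W.zero_mem, by simp⟩⟩
  | insert m s hm hmax ih =>
    by_cases h : ∃ v ∈ W, g m v ≠ 0
    · obtain ⟨v, hv, hgv⟩ := h
      have hlt : ∀ i ∈ s, rk i < rk m := fun i hi => lt_of_le_of_ne (hmax i hi) fun he => by
        rw [hrk he] at hi
        exact hm hi
      rw [ncard_signSets_insert g hm hv hgv, ncard_nbcSets_insert g hm hlt hv hgv, ih, ih]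
    · push Not at h
      have h1 : signSets g (insert m s) W = ∅ := Set.eq_empty_of_forall_notMem
        fun P ⟨_, x, hx, hP⟩ => (hP m (Finset.mem_insert_self m s)).1 (h x hx)
      have h2 : nbcSets g rk (insert m s) W = ∅ := Set.eq_empty_of_forall_notMem fun T hT => by
        obtain ⟨x, hx, -, hxm⟩ := hT.2 m (Finset.mem_insert_self m s)
        exact hxm (h x hx)
      rw [h1, h2]

end SignSets

end HyperplaneArrangement

namespace HyperplaneArrangement

/-! ### The intersection lattice of a central arrangement -/

section Lattice

variable {V : Type*} [AddCommGroup V] [Module ℝ V] {A : Finset (AffineSubspace ℝ V)}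

namespace IntersectionLattice

/-- The direction of the affine subspace `M_p`. -/
def dir (p : IntersectionLattice A) : Submodule ℝ V := p.flat.direction

theorem exists_flat_eq (p : IntersectionLattice A) :
    ∃ B ⊆ A, p.flat = sInf (B : Set (AffineSubspace ℝ V)) := by
  obtain ⟨B, hB, hp⟩ := p.2
  exact ⟨B, hB, congrArg OrderDual.ofDual hp⟩

theorem flat_sup (p q : IntersectionLattice A) : (p ⊔ q).flat = p.flat ⊓ q.flat := by
  rw [← sSup_pair]
  change sInf (flat '' {p, q}) = _
  rw [Set.image_pair, sInf_pair]

theorem exists_flat_eq_inf (p : IntersectionLattice A) {H : AffineSubspace ℝ V} (hH : H ∈ A) :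
    ∃ q : IntersectionLattice A, q.flat = p.flat ⊓ H := by
  have : ∃ q : IntersectionLattice A, q.flat = H :=
    ⟨⟨OrderDual.toDual H, {H}, by simpa using hH, by simp⟩, rfl⟩
  obtain ⟨q, hq⟩ := this
  exact ⟨p ⊔ q, by rw [flat_sup, hq]⟩

variable {c : V} (hc : ∀ H ∈ A, c ∈ H)

include hc

theorem center_mem_flat (p : IntersectionLattice A) : c ∈ p.flat := by
  obtain ⟨B, hB, hp⟩ := p.exists_flat_eq
  rw [hp, AffineSubspace.mem_sInf_iff]
  exact fun H hH => hc H (hB hH)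

theorem mem_flat_iff (p : IntersectionLattice A) {x : V} : x ∈ p.flat ↔ x - c ∈ p.dir :=
  (AffineSubspace.vsub_right_mem_direction_iff_mem (center_mem_flat hc p) x).symm

theorem le_iff_dir_le {p q : IntersectionLattice A} : p ≤ q ↔ q.dir ≤ p.dir := by
  rw [le_iff]
  refine ⟨AffineSubspace.direction_le, fun h x hx => ?_⟩
  rw [mem_flat_iff hc] at hx ⊢
  exact h hx

theorem dir_sup (p q : IntersectionLattice A) : (p ⊔ q).dir = p.dir ⊓ q.dir := by
  rw [dir, flat_sup]
  exact AffineSubspace.direction_inf_of_mem (center_mem_flat hc p) (center_mem_flat hc q)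

theorem dir_strictAnti : StrictAnti (dir : IntersectionLattice A → Submodule ℝ V) := by
  intro p q hpq
  rw [lt_iff_le_not_ge] at hpq ⊢
  rwa [← le_iff_dir_le hc, ← le_iff_dir_le hc]

end IntersectionLattice

end Lattice

section Rank

variable {V : Type*} [AddCommGroup V] [Module ℝ V] [FiniteDimensional ℝ V]
  {A : Finset (AffineSubspace ℝ V)}

theorem finrank_le_finrank_inf_ker_add_one (W : Submodule ℝ V) (f : Dual ℝ V) :
    finrank ℝ W ≤ finrank ℝ (W ⊓ LinearMap.ker f : Submodule ℝ V) + 1 := by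
  have h1 := Submodule.finrank_sup_add_finrank_inf_eq W (LinearMap.ker f)
  have h2 := Submodule.finrank_le (W ⊔ LinearMap.ker f)
  have h3 := LinearMap.finrank_range_add_finrank_ker f
  have h4 := Submodule.finrank_le (LinearMap.range f)
  rw [finrank_self] at h4
  omega

theorem IsHyperplane.exists_dual {H : AffineSubspace ℝ V} (hH : IsHyperplane H) :
    ∃ f : Dual ℝ V, H.direction = LinearMap.ker f := by
  have hlt : H.direction < ⊤ := by
    refine lt_top_iff_ne_top.2 fun h => ?_
    have := hH.2
    rw [h, finrank_top] at this
    omega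
  obtain ⟨f, hf, hle⟩ := Submodule.exists_le_ker_of_lt_top _ hlt
  refine ⟨f, Submodule.eq_of_le_of_finrank_eq hle ?_⟩
  have h1 := Module.Dual.finrank_ker_add_one_of_ne_zero hf
  have h2 := hH.2
  omega

namespace IntersectionLattice

theorem exists_dir_eq_inf_ker (hA : IsCentralArrangement A) {p q : IntersectionLattice A}
    {H : AffineSubspace ℝ V} (hH : H ∈ A) (hq : q.flat = p.flat ⊓ H) :
    ∃ f : Dual ℝ V, q.dir = p.dir ⊓ LinearMap.ker f := by
  obtain ⟨hhyp, c, hc⟩ := hA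
  obtain ⟨f, hf⟩ := (hhyp H hH).exists_dual
  refine ⟨f, ?_⟩
  rw [dir, hq, ← hf]
  exact AffineSubspace.direction_inf_of_mem (center_mem_flat hc p) (hc H hH)

theorem height_le_finrank_sub {c : V} (hc : ∀ H ∈ A, c ∈ H) {p : IntersectionLattice A}
    (q : Set.Ici p) : Order.height q ≤ ((finrank ℝ p.dir - finrank ℝ q.1.dir : ℕ) : ℕ∞) := by
  have hmono : StrictMono fun q : Set.Ici p => finrank ℝ p.dir - finrank ℝ q.1.dir := by
    intro q r hqr
    have h1 := Submodule.finrank_lt_finrank_of_lt (dir_strictAnti hc (Subtype.coe_lt_coe.2 hqr))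
    have h2 := Submodule.finrank_mono ((le_iff_dir_le hc).1 q.2)
    simp only
    omega
  simpa using Order.height_le_height_apply_of_strictMono _ hmono q

/-- The rank of `p` is the codimension of `M_p`. -/
theorem height_add_finrank_dir (hA : IsCentralArrangement A) (p : IntersectionLattice A) :
    Order.height p + (finrank ℝ p.dir : ℕ∞) = (finrank ℝ V : ℕ∞) := by
  classical
  obtain ⟨c, hc⟩ := hA.2
  apply le_antisymm
  · have hmono : StrictMono fun p : IntersectionLattice A => finrank ℝ V - finrank ℝ p.dir := by
      intro q r hqr
      have h1 := Submodule.finrank_lt_finrank_of_lt (dir_strictAnti hc hqr)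
      have h2 := Submodule.finrank_le q.dir
      simp only
      omega
    have h := Order.height_le_height_apply_of_strictMono _ hmono p
    rw [Order.height_nat] at h
    refine (add_le_add_left h _).trans ?_
    have h2 := Submodule.finrank_le p.dir
    rw [← Nat.cast_add]
    exact_mod_cast (by omega)
  · obtain ⟨B, hB, hp⟩ := p.exists_flat_eq
    induction B using Finset.induction_on generalizing p with
    | empty =>
      have : p.dir = ⊤ := by
        rw [dir, hp]
        simp
      rw [this, finrank_top]
      exact le_add_self
    | insert H B hHB ih =>
      obtain ⟨hH, hB'⟩ := Finset.insert_subset_iff.1 hB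
      let p' : IntersectionLattice A :=
        ⟨OrderDual.toDual (sInf (B : Set (AffineSubspace ℝ V))), B, hB', rfl⟩
      have hflat : p.flat = p'.flat ⊓ H := by
        rw [hp, Finset.coe_insert, sInf_insert, inf_comm]
        rfl
      have ih' := ih p' hB' rfl
      have hle : p' ≤ p := (le_iff _ _).2 (hflat.trans_le inf_le_left)
      rcases hle.eq_or_lt with he | hlt
      · rwa [← he]
      · obtain ⟨f, hf⟩ := exists_dir_eq_inf_ker hA hH hflat
        have h1 := finrank_le_finrank_inf_ker_add_one p'.dir f
        rw [← hf] at h1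
        calc (finrank ℝ V : ℕ∞) ≤ Order.height p' + (finrank ℝ p'.dir : ℕ∞) := ih'
          _ ≤ Order.height p' + ((finrank ℝ p.dir + 1 : ℕ) : ℕ∞) := by gcongr
          _ = (Order.height p' + 1) + (finrank ℝ p.dir : ℕ∞) := by
            push_cast
            ring
          _ ≤ Order.height p + (finrank ℝ p.dir : ℕ∞) := by
            gcongr
            exact Order.height_add_one_le hlt

end IntersectionLattice

end Rank

section Atoms

open IntersectionLattice OrlikSolomon

variable {V : Type*} [AddCommGroup V] [Module ℝ V] [FiniteDimensional ℝ V]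
  {A : Finset (AffineSubspace ℝ V)} {p : IntersectionLattice A}

/-- The atoms of `[p, 1]` are the intersections of `M_p` with hyperplanes of `A`, hence hyperplanes
of `M_p`. -/
theorem exists_dual_of_atom (hA : IsCentralArrangement A) (a : Atom (Set.Ici p)) :
    ∃ f : Dual ℝ V, a.1.1.dir = p.dir ⊓ LinearMap.ker f := by
  obtain ⟨a, ha⟩ := a
  have hpa : ¬ p.flat ≤ a.1.flat := fun h => ha.1 (le_bot_iff.1 (Subtype.coe_le_coe.1 h))
  obtain ⟨B, hB, hflat⟩ := a.1.exists_flat_eq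
  obtain ⟨H, hHB, hH⟩ : ∃ H ∈ B, ¬ p.flat ≤ H := by
    by_contra! h
    exact hpa (hflat ▸ le_sInf h)
  obtain ⟨q, hq⟩ := p.exists_flat_eq_inf (hB hHB)
  have hpq : p ≤ q := (le_iff _ _).2 (hq.trans_le inf_le_left)
  have hqa : (⟨q, hpq⟩ : Set.Ici p) ≤ a := Subtype.coe_le_coe.1 <| (le_iff _ _).2 <|
    (le_inf ((le_iff _ _).1 a.2) (hflat.trans_le (sInf_le hHB))).trans_eq hq.symm
  have hqa' : q = a.1 := by
    rcases ha.le_iff.1 hqa with h | h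
    · refine absurd ?_ hH
      have hqp : q = p := congrArg Subtype.val h
      rw [hqp] at hq
      exact hq.trans_le inf_le_right
    · exact congrArg Subtype.val h
  rw [← hqa']
  exact exists_dir_eq_inf_ker hA (hB hHB) hq

variable {c : V} (hc : ∀ H ∈ A, c ∈ H) {g : Atom (Set.Ici p) → Dual ℝ V}
  (hg : ∀ a, a.1.1.dir = p.dir ⊓ LinearMap.ker (g a))

include hc hg

omit [FiniteDimensional ℝ V] in
theorem mem_dir_sup_iff (U : Finset (Atom (Set.Ici p))) (x : V) :
    x ∈ (U.sup Subtype.val : Set.Ici p).1.dir ↔ x ∈ p.dir ∧ ∀ a ∈ U, g a x = 0 := by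
  classical
  induction U using Finset.induction_on with
  | empty =>
    rw [Finset.sup_empty]
    simp
  | insert a U ha ih =>
    rw [Finset.sup_insert]
    change x ∈ (a.1.1 ⊔ (U.sup Subtype.val : Set.Ici p).1).dir ↔ _
    rw [dir_sup hc, Submodule.mem_inf, ih, hg, Submodule.mem_inf, LinearMap.mem_ker]
    simp only [Finset.mem_insert, forall_eq_or_imp]
    tauto

/-- The rank of a join of atoms of `[p, 1]` is at most their number. -/
theorem height_sup_le_card (U : Finset (Atom (Set.Ici p))) :
    Order.height (U.sup Subtype.val) ≤ (U.card : ℕ∞) := by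
  classical
  refine (height_le_finrank_sub hc _).trans ?_
  suffices h : finrank ℝ p.dir ≤ finrank ℝ (U.sup Subtype.val : Set.Ici p).1.dir + U.card by
    exact_mod_cast (by omega)
  induction U using Finset.induction_on with
  | empty =>
    rw [Finset.sup_empty]
    exact le_self_add
  | insert a U ha ih =>
    have h : ((insert a U).sup Subtype.val : Set.Ici p).1.dir =
        (U.sup Subtype.val : Set.Ici p).1.dir ⊓ LinearMap.ker (g a) := by
      ext x
      rw [Submodule.mem_inf, mem_dir_sup_iff hc hg, mem_dir_sup_iff hc hg, LinearMap.mem_ker]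
      simp only [Finset.mem_insert, forall_eq_or_imp]
      tauto
    have h1 := finrank_le_finrank_inf_ker_add_one (U.sup Subtype.val : Set.Ici p).1.dir (g a)
    rw [h, Finset.card_insert_of_notMem ha]
    omega

omit [FiniteDimensional ℝ V] in
/-- An atom lies below a join of atoms if and only if its functional vanishes on `M_p` wherever
theirs do; so the two notions of a set without broken circuits agree. -/
theorem isNBC_iff [Fintype (Atom (Set.Ici p))] (rk : Atom (Set.Ici p) → ℕ)
    (T : Finset (Atom (Set.Ici p))) : IsNBC rk T ↔ T ∈ nbcSets g rk Finset.univ p.dir := by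
  have key : ∀ (a : Atom (Set.Ici p)) (U : Finset (Atom (Set.Ici p))),
      a.1 ≤ U.sup Subtype.val ↔ ∀ x ∈ p.dir, (∀ j ∈ U, g j x = 0) → g a x = 0 := by
    intro a U
    rw [← Subtype.coe_le_coe, le_iff_dir_le hc, SetLike.le_def]
    simp only [mem_dir_sup_iff hc hg, hg a, Submodule.mem_inf, LinearMap.mem_ker, and_imp]
    exact forall_congr' fun x => ⟨fun h h1 h2 => (h h1 h2).2, fun h h1 h2 => ⟨h1, h h1 h2⟩⟩
  simp only [IsNBC, nbcSets, key]
  simp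

omit [FiniteDimensional ℝ V] in
theorem mem_stratum_iff (x : V) :
    x ∈ p.stratum ↔ x - c ∈ p.dir ∧ ∀ a, g a (x - c) ≠ 0 := by
  have hmem : ∀ a : Atom (Set.Ici p), x - c ∈ p.dir → (x ∈ a.1.1.flat ↔ g a (x - c) = 0) := by
    intro a hx
    rw [mem_flat_iff hc, hg, Submodule.mem_inf, LinearMap.mem_ker, and_iff_right hx]
  rw [stratum, Set.mem_sdiff, SetLike.mem_coe, mem_flat_iff hc]
  refine and_congr_right fun hx => ?_
  simp only [Set.mem_iUnion, not_exists, SetLike.mem_coe]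
  constructor
  · intro h a ha
    exact h ⟨a.1.1, Subtype.coe_lt_coe.2 a.2.bot_lt⟩ ((hmem a hx).2 ha)
  · rintro h ⟨q, hq⟩ hxq
    have hne : (⟨q, hq.le⟩ : Set.Ici p) ≠ ⊥ := fun he => hq.ne' (congrArg Subtype.val he)
    have : Finite (Set.Ici p) := Subtype.finite
    obtain ⟨a, ha, haq⟩ := (IsAtomic.eq_bot_or_exists_atom_le _).resolve_left hne
    exact h ⟨a, ha⟩ ((hmem ⟨a, ha⟩ hx).1 ((le_iff _ _).1 (Subtype.coe_le_coe.2 haq) hxq))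

end Atoms

/-! ### Faces and regions -/

section Components

open IntersectionLattice

variable {V : Type*} [AddCommGroup V] [Module ℝ V] [TopologicalSpace V]
  {A : Finset (AffineSubspace ℝ V)}

/-- The faces which are components of the stratum `S_p`. -/
def components (p : IntersectionLattice A) : Set (Set V) := {F | ∃ x ∈ p.stratum, F = connectedComponentIn p.stratum x}

/-- Different strata are disjoint, and so are their sets of components. -/
theorem disjoint_components {p q : IntersectionLattice A} (hpq : p ≠ q) :
    Disjoint (components p) (components q) := by
  rw [Set.disjoint_left]
  rintro F ⟨x, hx, rfl⟩ ⟨y, -, hxy⟩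
  have hxq : x ∈ q.stratum := connectedComponentIn_subset _ y (hxy ▸ mem_connectedComponentIn hx)
  have hmem : x ∈ (p ⊔ q).flat := by
    rw [flat_sup, AffineSubspace.mem_inf_iff]
    exact ⟨hx.1, hxq.1⟩
  have key : ∀ r : IntersectionLattice A, x ∈ r.stratum → r ≤ p ⊔ q → r = p ⊔ q := fun r hr hle =>
    hle.eq_of_not_lt fun hlt => hr.2 (Set.mem_iUnion.2 ⟨⟨p ⊔ q, hlt⟩, hmem⟩)
  exact hpq ((key p hx le_sup_left).trans (key q hxq le_sup_right).symm)

theorem pos_of_isPreconnected {X : Type*} [TopologicalSpace X] {C : Set X} (hC : IsPreconnected C) {h : X → ℝ} (hh : Continuous h)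
    (h0 : ∀ z ∈ C, h z ≠ 0) {x y : X} (hx : x ∈ C) (hy : y ∈ C) (hpos : 0 < h x) : 0 < h y := by
  by_contra! hle
  obtain ⟨z, hz, hz0⟩ := hC.intermediate_value hy hx hh.continuousOn ⟨hle, hpos.le⟩
  exact h0 z hz hz0

end Components

section Faces

open IntersectionLattice OrlikSolomon

variable {V : Type*} [NormedAddCommGroup V] [NormedSpace ℝ V] [FiniteDimensional ℝ V]
  {A : Finset (AffineSubspace ℝ V)} {p : IntersectionLattice A}

variable {c : V} (hc : ∀ H ∈ A, c ∈ H) {g : Atom (Set.Ici p) → Dual ℝ V}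
  (hg : ∀ a, a.1.1.dir = p.dir ⊓ LinearMap.ker (g a))

include hc hg

/-- The component of a point of `S_p` consists of the points at which the functionals defining
the atoms have the same signs. -/
theorem mem_connectedComponentIn_iff {x : V} (hx : x ∈ p.stratum) (y : V) :
    y ∈ connectedComponentIn p.stratum x ↔
      y - c ∈ p.dir ∧ ∀ a, 0 < g a (x - c) * g a (y - c) := by
  have hx' := (mem_stratum_iff hc hg x).1 hx
  constructor
  · intro hy
    have hsub := connectedComponentIn_subset p.stratum x
    refine ⟨((mem_stratum_iff hc hg y).1 (hsub hy)).1, fun a => ?_⟩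
    have hcont : Continuous fun z => g a (x - c) * g a (z - c) :=
      ((g a).continuous_of_finiteDimensional.comp (continuous_id.sub continuous_const)).const_mul _
    exact pos_of_isPreconnected isPreconnected_connectedComponentIn hcont
      (fun z hz => mul_ne_zero (hx'.2 a) (((mem_stratum_iff hc hg z).1 (hsub hz)).2 a))
      (mem_connectedComponentIn hx) hy (mul_self_pos.2 (hx'.2 a))
  · intro hy
    -- These points form a convex, hence connected, subset of the stratum.
    let C : Set V := {y | y - c ∈ p.dir ∧ ∀ a, 0 < g a (x - c) * g a (y - c)}
    have hconv : Convex ℝ C := by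
      intro y hy z hz s t hs ht hst
      have he : s • y + t • z - c = s • (y - c) + t • (z - c) := by
        rw [smul_sub, smul_sub, sub_add_sub_comm, ← add_smul, hst, one_smul]
      refine ⟨?_, fun a => ?_⟩
      · rw [he]
        exact add_mem (p.dir.smul_mem s hy.1) (p.dir.smul_mem t hz.1)
      · have h := (convex_Ioi (0 : ℝ)) (hy.2 a) (hz.2 a) hs ht hst
        rw [he, map_add, map_smul, map_smul]
        simp only [smul_eq_mul, Set.mem_Ioi] at h ⊢
        linarith
    have hsub : C ⊆ p.stratum := fun z hz => (mem_stratum_iff hc hg z).2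
      ⟨hz.1, fun a => right_ne_zero_of_mul (hz.2 a).ne'⟩
    exact hconv.isPreconnected.subset_connectedComponentIn
      ⟨hx'.1, fun a => mul_self_pos.2 (hx'.2 a)⟩ hsub hy

theorem finite_and_ncard_components [Fintype (Atom (Set.Ici p))] :
    (components p).Finite ∧
      (components p).ncard = (signSets g Finset.univ p.dir).ncard := by
  classical
  -- The region with the set `P` of positive functionals.
  let cell : Finset (Atom (Set.Ici p)) → Set V := fun P =>
    {y | y - c ∈ p.dir ∧ ∀ a, g a (y - c) ≠ 0 ∧ (a ∈ P ↔ 0 < g a (y - c))}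
  have hcell : ∀ x ∈ p.stratum, ∀ P : Finset (Atom (Set.Ici p)),
      (∀ a, a ∈ P ↔ 0 < g a (x - c)) → cell P = connectedComponentIn p.stratum x := by
    intro x hx P hP
    have hx' := (mem_stratum_iff hc hg x).1 hx
    ext y
    rw [mem_connectedComponentIn_iff hc hg hx]
    refine and_congr_right fun _ => forall_congr' fun a => ⟨fun h => ?_, fun h =>
      ne_zero_and_iff_of_mul_pos h (hP a)⟩
    have hiff := (hP a).symm.trans h.2
    rcases (hx'.2 a).lt_or_gt with hneg | hpos
    · exact mul_pos_of_neg_of_neg hneg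
        (lt_of_le_of_ne (not_lt.1 fun h' => hneg.not_gt (hiff.2 h')) h.1)
    · exact mul_pos hpos (hiff.1 hpos)
  have himage : components p = cell '' signSets g Finset.univ p.dir := by
    ext F
    constructor
    · rintro ⟨x, hx, rfl⟩
      have hx' := (mem_stratum_iff hc hg x).1 hx
      refine ⟨Finset.univ.filter fun a => 0 < g a (x - c), ⟨Finset.subset_univ _, x - c, hx'.1,
        fun a _ => ⟨hx'.2 a, by simp⟩⟩, hcell x hx _ (by simp)⟩
    · rintro ⟨P, ⟨-, x, hxW, hx⟩, rfl⟩
      have hxs : x + c ∈ p.stratum := (mem_stratum_iff hc hg _).2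
        ⟨by simpa using hxW, fun a => by simpa using (hx a (Finset.mem_univ a)).1⟩
      exact ⟨x + c, hxs, hcell _ hxs P fun a => by simpa using (hx a (Finset.mem_univ a)).2⟩
  have hinj : Set.InjOn cell (signSets g Finset.univ p.dir) := by
    rintro P ⟨-, x, hxW, hx⟩ Q - hPQ
    have hxP : x + c ∈ cell P :=
      ⟨by simpa using hxW, fun a => by simpa using hx a (Finset.mem_univ a)⟩
    have hxQ : x + c ∈ cell Q := hPQ ▸ hxP
    ext a
    exact (hxP.2 a).2.trans (hxQ.2 a).2.symm
  rw [himage]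
  exact ⟨(finite_signSets _ _ _).image _, hinj.ncard_image⟩

/-- A component of `S_p` is relatively open in `M_p`, hence spans it. -/
theorem direction_affineSpan_of_mem_components [Fintype (Atom (Set.Ici p))] {F : Set V}
    (hF : F ∈ components p) : (affineSpan ℝ F).direction = p.dir := by
  obtain ⟨x, hx, rfl⟩ := hF
  rw [direction_affineSpan]
  apply le_antisymm
  · rw [vectorSpan_def, Submodule.span_le]
    rintro _ ⟨y, hy, z, hz, rfl⟩
    have hy' := ((mem_connectedComponentIn_iff hc hg hx y).1 hy).1
    have hz' := ((mem_connectedComponentIn_iff hc hg hx z).1 hz).1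
    have := sub_mem hy' hz'
    rwa [sub_sub_sub_cancel_right] at this
  · intro v hv
    have hx' := (mem_stratum_iff hc hg x).1 hx
    obtain ⟨t, ht, h⟩ := exists_pos_forall_mul_pos g Finset.univ (fun a _ => hx'.2 a) v
    have he : x + t • v - c = x - c + t • v := by abel
    have hmem : x + t • v ∈ connectedComponentIn p.stratum x := by
      rw [mem_connectedComponentIn_iff hc hg hx, he]
      exact ⟨add_mem hx'.1 (p.dir.smul_mem t hv), fun a => h a (Finset.mem_univ a)⟩
    have := vsub_mem_vectorSpan ℝ hmem (mem_connectedComponentIn hx)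
    rw [vsub_eq_sub, add_sub_cancel_left] at this
    exact (Submodule.smul_mem_iff _ ht.ne').1 this

omit hc hg in
/-- The components of `S_p` are the regions of the restriction of `A` to `M_p`; their number is
the dimension of the Orlik–Solomon algebra of `[p, 1]`. -/
theorem components_and_osAlgebra (K : Type*) [Field K] (hA : IsCentralArrangement A)
    (p : IntersectionLattice A) :
    (components p).Finite ∧ Module.Finite K (OSAlgebra K (Set.Ici p)) ∧
      (components p).ncard = finrank K (OSAlgebra K (Set.Ici p)) ∧
      ∀ F ∈ components p, finrank ℝ (affineSpan ℝ F).direction = finrank ℝ p.dir := by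
  classical
  have : Finite (Atom (Set.Ici p)) := Subtype.finite
  have : Fintype (Atom (Set.Ici p)) := Fintype.ofFinite _
  choose g hg using exists_dual_of_atom (p := p) hA
  obtain ⟨-, c, hc⟩ := hA
  obtain ⟨rk, hrk⟩ := exists_injective_nat (Atom (Set.Ici p))
  have b := nbcBasis K hrk (height_sup_le_card hc hg)
  obtain ⟨hfin, hcard⟩ := finite_and_ncard_components hc hg
  refine ⟨hfin, Module.Finite.of_basis b, ?_, fun F hF => by
    rw [direction_affineSpan_of_mem_components hc hg hF]⟩
  rw [hcard, ncard_signSets_eq_ncard_nbcSets g hrk, finrank_eq_nat_card_basis b,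
    ← Nat.card_coe_set_eq]
  exact Nat.card_congr (Equiv.subtypeEquivRight fun T => (isNBC_iff hc hg rk T).symm)

end Faces

end HyperplaneArrangement

theorem mainTheorem12 (K : Type*) [Field K] (d : ℕ)
    (A : Finset (AffineSubspace ℝ (EuclideanSpace ℝ (Fin d))))
    (hA : HyperplaneArrangement.IsCentralArrangement A) (k : ℕ) :
    (HyperplaneArrangement.faces A k).Finite ∧
    (∀ p : HyperplaneArrangement.IntersectionLattice A,
      Module.Finite K (OrlikSolomon.OSAlgebra K (Set.Ici p))) ∧
    (HyperplaneArrangement.faces A k).ncard =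
      ∑ p : HyperplaneArrangement.IntersectionLattice A with
          Order.height p + (k : ℕ∞) = (d : ℕ∞),
        Module.finrank K (OrlikSolomon.OSAlgebra K (Set.Ici p)) := by
  classical
  have hcomp := HyperplaneArrangement.components_and_osAlgebra K hA
  have hdim : ∀ p : HyperplaneArrangement.IntersectionLattice A,
      Order.height p + (k : ℕ∞) = (d : ℕ∞) ↔ finrank ℝ p.dir = k := by
    intro p
    have h := HyperplaneArrangement.IntersectionLattice.height_add_finrank_dir hA p
    rw [finrank_euclideanSpace_fin] at h
    have hfin : Order.height p ≠ ⊤ := fun ht => by simp [ht] at h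
    rw [← h, (ENat.add_right_injective_of_ne_top hfin).eq_iff, Nat.cast_inj, eq_comm]
  have hfaces : HyperplaneArrangement.faces A k =
      ↑((Finset.univ.filter fun p : HyperplaneArrangement.IntersectionLattice A =>
        Order.height p + (k : ℕ∞) = (d : ℕ∞)).biUnion fun p => (hcomp p).1.toFinset) := by
    ext F
    simp only [Finset.coe_biUnion, Finset.mem_coe, Finset.mem_filter, Finset.mem_univ, true_and,
      Set.Finite.coe_toFinset, Set.mem_iUnion, exists_prop, hdim]
    constructor
    · rintro ⟨⟨p, hF⟩, hk⟩
      exact ⟨p, ((hcomp p).2.2.2 F hF).symm.trans hk, hF⟩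
    · rintro ⟨p, hk, hF⟩
      exact ⟨⟨p, hF⟩, ((hcomp p).2.2.2 F hF).trans hk⟩
  refine ⟨hfaces ▸ Finset.finite_toSet _, fun p => (hcomp p).2.1, ?_⟩
  rw [hfaces, Set.ncard_coe_finset, Finset.card_biUnion]
  · refine Finset.sum_congr rfl fun p _ => ?_
    exact (Set.ncard_eq_toFinset_card _ (hcomp p).1).symm.trans (hcomp p).2.2.1
  · intro p _ q _ hpq
    exact Set.Finite.disjoint_toFinset.2 (HyperplaneArrangement.disjoint_components hpq)
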